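/- Let $n\ge 4$, let $G=(N,A)$ be the complete directed graph on $N=\{1,\dots,n\}$, with $A=\{ij : i,j\in N,\ i\ne j\}$, and let $N_1=N\setminus\{1\}$. For $S\subseteq N$ let $\delta^+(S)$ (respectively $\delta^-(S)$) be the set of arcs that leave (respectively enter) $S$, let $A(S)$ be the set of arcs with both ends in $S$, and write $\delta^\pm(i)=\delta^\pm(\{i\})$. Let $\mathcal S_1$ be the family of all $S\subseteq N_1$ with $|S|\ge 2$. Let $$P_{\mathrm{AP}}=\Big\{x\in[0,1]^A : \sum_{a\in\delta^+(i)}x_a=1\ \text{ and }\ \sum_{a\in\delta^-(i)}x_a=1\ \text{ for all } i\in N\Big\}$$ be the assignment polytope, and let $\overline B=\{b\in\mathbb R_+^{N_1} : \sum_{i\in N_1}b_i=1\}$. For $b\in\overline B$ let $P_{\mathrm{SCF}}(b)$ be the projection onto the $x$-variables of the $b$-SCF relaxation, that is, the set of all $x\in P_{\mathrm{AP}}$ for which there is $f\in\mathbb R_+^A$ with $$\sum_{a\in\delta^+(i)}f_a-\sum_{a\in\delta^-(i)}f_a=\begin{cases}1 & i=1\\ -b_i & i\in N_1\end{cases}\qquad\text{and}\qquad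 f_a\le x_a\ \text{ for all } a\in A.$$ Then, for every $b\in\overline B$, $$P_{\mathrm{SCF}}(b)=\Big\{x\in P_{\mathrm{AP}} : \sum_{ij\in\delta^+(S)}x_{ij}\ge\sum_{i\in S}b_i\ \text{ for all } S\in\mathcal S_1\Big\}.$$ Moreover, for all $x\in P_{\mathrm{AP}}$ and $S\in\mathcal S_1$, the inequality $\sum_{ij\in\delta^+(S)}x_{ij}\ge\sum_{i\in S}b_i$ holds if and only if $\sum_{ij\in A(S)}x_{ij}\le|S|-\sum_{i\in S}b_i$, and hence $$P_{\mathrm{SCF}}(b)=\Big\{x\in P_{\mathrm{AP}} : \sum_{ij\in A(S)}x_{ij}\le|S|-\sum_{i\in S}b_i\ \text{ for all } S\in\mathcal S_1\Big\}.$$ The latter inequalities generalize the weak clique inequalities: the vector $b$ with all $b_i=\frac1{n-1}$ belongs to $\overline B$, for it the right-hand side $|S|-\sum_{i\in S}b_i$ equals $|S|-\frac{|S|}{n-1}$ for every $S\in\mathcal S_1$, and $P_{\mathrm{SCF}}(b)$ is the set of all $x\in P_{\mathrm{AP}}$ with $\sum_{ij\in A(S)}x_{ij}\le|S|-\frac{|S|}{n-1}$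 for all $S\in\mathcal S_1$. -/

import Mathlib

open scoped BigOperators

noncomputable section

/-- The arc set `A = {ij : i, j ∈ N, i ≠ j}` of the complete directed graph on the node set `V`. -/
abbrev Arc (V : Type*) := {p : V × V // p.1 ≠ p.2}

/-- The set `N₁` of the nodes other than the special node `r` (node `1` in the usual numbering). -/
abbrev N1 {V : Type*} (r : V) := {i : V // i ≠ r}

/-- `δ⁺(S)`: the arcs leaving `S`. -/
def deltaOut {V : Type*} [Fintype V] [DecidableEq V] (S : Finset V) : Finset (Arc V) :=
  Finset.univ.filter fun a => a.1.1 ∈ S ∧ a.1.2 ∉ S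

/-- `δ⁻(S)`: the arcs entering `S`. -/
def deltaIn {V : Type*} [Fintype V] [DecidableEq V] (S : Finset V) : Finset (Arc V) :=
  Finset.univ.filter fun a => a.1.1 ∉ S ∧ a.1.2 ∈ S

/-- `A(S)`: the arcs with both end nodes in `S`. -/
def arcsIn {V : Type*} [Fintype V] [DecidableEq V] (S : Finset V) : Finset (Arc V) :=
  Finset.univ.filter fun a => a.1.1 ∈ S ∧ a.1.2 ∈ S

/-- A set of nodes different from `r`, regarded as a set of nodes. -/
def nodes {V : Type*} {r : V} (S : Finset (N1 r)) : Finset V :=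
  S.map (Function.Embedding.subtype fun i => i ≠ r)

/-- The family `𝒮₁` of the subsets of `N₁` of size at least two. -/
def S1 {V : Type*} (r : V) : Set (Finset (N1 r)) := {S | 2 ≤ S.card}

/-- The (restricted) assignment polytope `P_AP`. -/
def PAP (V : Type*) [Fintype V] [DecidableEq V] : Set (Arc V → ℝ) :=
  {x | (∀ a, 0 ≤ x a ∧ x a ≤ 1) ∧
    (∀ i : V, ∑ a ∈ deltaOut {i}, x a = 1) ∧
    (∀ i : V, ∑ a ∈ deltaIn {i}, x a = 1)}

/-- The parameter set `{b ∈ ℝ₊^{N₁} : ∑ b_i = 1}`. -/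
def Bbar {V : Type*} [Fintype V] [DecidableEq V] (r : V) : Set (N1 r → ℝ) :=
  {b | (∀ i, 0 ≤ b i) ∧ ∑ i, b i = 1}

/-- The polyhedron `Q_SCF(b)` of the linear relaxation of the `b`-SCF formulation. -/
def QSCF {V : Type*} [Fintype V] [DecidableEq V] (r : V) (b : N1 r → ℝ) :
    Set ((Arc V → ℝ) × (Arc V → ℝ)) :=
  {q | q.1 ∈ PAP V ∧ (∀ a, 0 ≤ q.2 a) ∧
    (∑ a ∈ deltaOut {r}, q.2 a - ∑ a ∈ deltaIn {r}, q.2 a = 1) ∧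
    (∀ i : N1 r, ∑ a ∈ deltaOut {i.1}, q.2 a - ∑ a ∈ deltaIn {i.1}, q.2 a = -b i) ∧
    (∀ a, q.2 a ≤ q.1 a)}

/-- `P_SCF(b)`, the projection of `Q_SCF(b)` onto the `x`-variables. -/
def PSCF {V : Type*} [Fintype V] [DecidableEq V] (r : V) (b : N1 r → ℝ) : Set (Arc V → ℝ) :=
  Prod.fst '' QSCF r b

/-- The parameter `b` with all entries equal to `1 / (n - 1)`, where `n` is the number of nodes. -/
def uniformB {V : Type*} [Fintype V] (r : V) : N1 r → ℝ :=
  fun _ => 1 / ((Fintype.card V : ℝ) - 1)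

end

/-! For fixed `x`, the flow `f` exists exactly when the demand `b` can be shipped from the root
within the capacities `x`. By Gale's theorem (`exists_flow_of_cut_condition`) this means that no
node set demands more than the capacity entering it. The degree equations give every set equal
entering and leaving capacity, so for sets avoiding the root this is the cut inequality. Since `b`
is nonnegative with sum one, the condition is automatic for sets of size at most one avoiding the
root and for sets containing it. Summing out-degree equations over `S` turns cuts into cliques.

Gale's theorem is proved by minimizing the sum of squared deficits over the box of admissible flows.
At a minimizer, the set of nodes of maximal deficit has saturated entering arcs and empty leaving
arcs, so the cut condition makes that maximum nonpositive; as the deficits sum to zero, they all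
vanish. -/

section

variable {V : Type*} [Fintype V] [DecidableEq V]

/-- The net inflow of `f` into a set of nodes, as a signed sum over all arcs. -/
lemma sum_deltaIn_sub_sum_deltaOut (f : Arc V → ℝ) (S : Finset V) :
    ∑ a ∈ deltaIn S, f a - ∑ a ∈ deltaOut S, f a =
      ∑ a : Arc V, f a * ((if a.1.2 ∈ S then 1 else 0) - (if a.1.1 ∈ S then 1 else 0)) := by
  rw [deltaIn, deltaOut, Finset.sum_filter, Finset.sum_filter, ← Finset.sum_sub_distrib]
  refine Finset.sum_congr rfl fun a _ => ?_
  by_cases h1 : a.1.1 ∈ S <;> by_cases h2 : a.1.2 ∈ S <;> simp [h1, h2]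

/-- The net inflow of `f` into a set of nodes is the sum of the net inflows into its elements. -/
lemma sum_netInflow_singleton (f : Arc V → ℝ) (S : Finset V) :
    ∑ i ∈ S, (∑ a ∈ deltaIn {i}, f a - ∑ a ∈ deltaOut {i}, f a) =
      ∑ a ∈ deltaIn S, f a - ∑ a ∈ deltaOut S, f a := by
  simp only [sum_deltaIn_sub_sum_deltaOut]
  rw [Finset.sum_comm]
  refine Finset.sum_congr rfl fun a _ => ?_
  rw [← Finset.mul_sum, Finset.sum_sub_distrib]
  simp

/-- The total outflow of the elements of `S` splits into the arcs inside `S` and those leaving. -/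
lemma sum_outflow_singleton (x : Arc V → ℝ) (S : Finset V) :
    ∑ i ∈ S, ∑ a ∈ deltaOut {i}, x a = ∑ a ∈ arcsIn S, x a + ∑ a ∈ deltaOut S, x a := by
  simp only [deltaOut, arcsIn, Finset.sum_filter]
  rw [Finset.sum_comm, ← Finset.sum_add_distrib]
  refine Finset.sum_congr rfl fun a _ => ?_
  have h (i : V) : (a.1.1 ∈ ({i} : Finset V) ∧ a.1.2 ∉ ({i} : Finset V)) ↔ a.1.1 = i := by
    simp only [Finset.mem_singleton]
    exact ⟨fun h => h.1, fun h => ⟨h, fun h' => a.2 (h.trans h'.symm)⟩⟩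
  simp only [h, Finset.sum_ite_eq]
  by_cases h1 : a.1.1 ∈ S <;> by_cases h2 : a.1.2 ∈ S <;> simp [h1, h2]

/-- The net inflows of all nodes cancel. -/
lemma sum_netInflow_univ (f : Arc V → ℝ) :
    ∑ i : V, (∑ a ∈ deltaIn {i}, f a - ∑ a ∈ deltaOut {i}, f a) = 0 := by
  rw [sum_netInflow_singleton, sum_deltaIn_sub_sum_deltaOut]
  simp

/-- For small `τ` the linear term dominates the quadratic one; this is first-order optimality
without derivatives. -/
lemma nonpos_of_forall_mul_le_sq {D K ε : ℝ} (hε : 0 < ε) (hK : 0 ≤ K)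
    (h : ∀ τ, 0 < τ → τ ≤ ε → 2 * τ * D ≤ τ ^ 2 * K) : D ≤ 0 := by
  by_contra! hD
  have hK1 : 0 < K + 1 := by linarith
  -- With this `τ`, `τ ^ 2 * K ≤ τ * D < 2 * τ * D`.
  have hτ : 0 < min ε (D / (K + 1)) := lt_min hε (by positivity)
  have h1 := h _ hτ (min_le_left _ _)
  have h2 : min ε (D / (K + 1)) * (K + 1) ≤ D := (le_div_iff₀ hK1).1 (min_le_right _ _)
  nlinarith

/-- Changing `f` by `τ` on the arc `a` changes the sum of the squared deficits accordingly. -/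
lemma sum_sq_deficit_add_single (d : V → ℝ) (f : Arc V → ℝ) (a : Arc V) (τ : ℝ) :
    ∑ i, (d i - (∑ b ∈ deltaIn {i}, (f + Pi.single a τ : Arc V → ℝ) b -
        ∑ b ∈ deltaOut {i}, (f + Pi.single a τ : Arc V → ℝ) b)) ^ 2 =
      ∑ i, (d i - (∑ b ∈ deltaIn {i}, f b - ∑ b ∈ deltaOut {i}, f b)) ^ 2 -
        2 * τ * ((d a.1.2 - (∑ b ∈ deltaIn {a.1.2}, f b - ∑ b ∈ deltaOut {a.1.2}, f b)) -
          (d a.1.1 - (∑ b ∈ deltaIn {a.1.1}, f b - ∑ b ∈ deltaOut {a.1.1}, f b))) +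
        τ ^ 2 * ∑ i, ((if a.1.2 = i then 1 else 0) - (if a.1.1 = i then 1 else 0)) ^ 2 := by
  set e : V → ℝ := fun i => d i - (∑ b ∈ deltaIn {i}, f b - ∑ b ∈ deltaOut {i}, f b) with he
  set w : V → ℝ := fun i => (if a.1.2 = i then 1 else 0) - (if a.1.1 = i then 1 else 0) with hw
  have h1 (i : V) : d i - (∑ b ∈ deltaIn {i}, (f + Pi.single a τ : Arc V → ℝ) b -
      ∑ b ∈ deltaOut {i}, (f + Pi.single a τ : Arc V → ℝ) b) = e i - τ * w i := by
    have h : ∑ b ∈ deltaIn {i}, (Pi.single a τ : Arc V → ℝ) b -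
        ∑ b ∈ deltaOut {i}, (Pi.single a τ : Arc V → ℝ) b = τ * w i := by
      rw [sum_deltaIn_sub_sum_deltaOut, Finset.sum_eq_single a]
      · simp [hw]
      · intro b _ hb
        simp [hb]
      · simp
    simp only [Pi.add_apply, Finset.sum_add_distrib, he]
    linarith
  have h2 : ∑ i, e i * w i = e a.1.2 - e a.1.1 := by
    simp [hw, mul_sub, Finset.sum_sub_distrib]
  change _ = ∑ i, e i ^ 2 - 2 * τ * (e a.1.2 - e a.1.1) + τ ^ 2 * ∑ i, w i ^ 2
  simp only [h1, ← h2, Finset.mul_sum, ← Finset.sum_sub_distrib, ← Finset.sum_add_distrib]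
  exact Finset.sum_congr rfl fun i _ => by ring

/-- Gale's supply-demand theorem: a demand `d` with total zero is met by a flow within the
capacities `c` if no set of nodes demands more than the capacity of the arcs entering it. -/
theorem exists_flow_of_cut_condition (d : V → ℝ) (c : Arc V → ℝ) (hc : ∀ a, 0 ≤ c a)
    (hd : ∑ i, d i = 0) (hcut : ∀ S : Finset V, ∑ i ∈ S, d i ≤ ∑ a ∈ deltaIn S, c a) :
    ∃ f : Arc V → ℝ, (∀ a, 0 ≤ f a) ∧ (∀ a, f a ≤ c a) ∧
      ∀ i, ∑ a ∈ deltaIn {i}, f a - ∑ a ∈ deltaOut {i}, f a = d i := by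
  obtain ⟨f, ⟨hf0, hfc⟩, hmin⟩ := (isCompact_Icc (a := (0 : Arc V → ℝ)) (b := c)).exists_isMinOn
    ⟨0, le_rfl, hc⟩ (f := fun f => ∑ i, (d i - (∑ a ∈ deltaIn {i}, f a -
      ∑ a ∈ deltaOut {i}, f a)) ^ 2) (by fun_prop)
  refine ⟨f, hf0, hfc, ?_⟩
  set e : V → ℝ := fun i => d i - (∑ b ∈ deltaIn {i}, f b - ∑ b ∈ deltaOut {i}, f b) with he
  have hopt (a : Arc V) (τ : ℝ) (h0 : 0 ≤ f a + τ) (h1 : f a + τ ≤ c a) :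
      2 * τ * (e a.1.2 - e a.1.1) ≤
        τ ^ 2 * ∑ i, ((if a.1.2 = i then 1 else 0) - (if a.1.1 = i then 1 else 0)) ^ 2 := by
    have hmem : f + Pi.single a τ ∈ Set.Icc (0 : Arc V → ℝ) c := by
      constructor <;> intro b <;> by_cases hb : b = a
      · subst hb; simpa using h0
      · simpa [hb] using hf0 b
      · subst hb; simpa using h1
      · simpa [hb] using hfc b
    have h := hmin hmem
    simp only [Set.mem_ofPred_eq] at h
    rw [sum_sq_deficit_add_single] at h
    linarith
  -- Otherwise a little more flow towards the larger deficit would lower the objective.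
  have hsat (a : Arc V) (h : e a.1.1 < e a.1.2) : f a = c a := by
    by_contra hne
    have hlt : f a < c a := lt_of_le_of_ne (hfc a) hne
    have := nonpos_of_forall_mul_le_sq (sub_pos.2 hlt)
      (Finset.sum_nonneg fun i _ => sq_nonneg _)
      fun τ hτ hτ' => hopt a τ (add_nonneg (hf0 a) hτ.le) (by linarith)
    linarith
  -- Otherwise withdrawing a little flow from the arc would lower the objective.
  have hzero (a : Arc V) (h : e a.1.2 < e a.1.1) : f a = 0 := by
    by_contra hne
    have hlt : 0 < f a := lt_of_le_of_ne (hf0 a) (Ne.symm hne)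
    have := nonpos_of_forall_mul_le_sq (D := e a.1.1 - e a.1.2) hlt
      (Finset.sum_nonneg fun i _ => sq_nonneg _)
      fun τ hτ hτ' => by
        have := hopt a (-τ) (by linarith) (by linarith [hfc a])
        rw [neg_sq] at this
        linarith
    linarith
  have hsum : ∑ i, e i = 0 := by
    rw [he, Finset.sum_sub_distrib, hd, sum_netInflow_univ, sub_zero]
  have hnonpos (i : V) : e i ≤ 0 := by
    obtain ⟨m, -, hm⟩ := Finset.exists_max_image Finset.univ e ⟨i, Finset.mem_univ i⟩
    refine (hm i (Finset.mem_univ i)).trans ?_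
    set S : Finset V := Finset.univ.filter fun j => e j = e m with hS
    have hlt {j : V} (hj : j ∉ S) : e j < e m :=
      lt_of_le_of_ne (hm j (Finset.mem_univ j)) (by simpa [hS] using hj)
    have heq {j : V} (hj : j ∈ S) : e j = e m := by simpa [hS] using hj
    have hin : ∑ a ∈ deltaIn S, f a = ∑ a ∈ deltaIn S, c a := by
      refine Finset.sum_congr rfl fun a ha => hsat a ?_
      obtain ⟨h1, h2⟩ := (Finset.mem_filter.1 ha).2
      rw [heq h2]
      exact hlt h1
    have hout : ∑ a ∈ deltaOut S, f a = 0 := by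
      refine Finset.sum_eq_zero fun a ha => hzero a ?_
      obtain ⟨h1, h2⟩ := (Finset.mem_filter.1 ha).2
      rw [heq h1]
      exact hlt h2
    -- The net inflow into `S` is its full entering capacity, which covers its demand.
    have hle : ∑ j ∈ S, e j ≤ 0 := by
      rw [he, Finset.sum_sub_distrib, sum_netInflow_singleton, hin, hout]
      linarith [hcut S]
    rw [Finset.sum_congr rfl fun j hj => heq hj, Finset.sum_const, nsmul_eq_mul] at hle
    have hcard : (0 : ℝ) < S.card := by
      exact_mod_cast Finset.card_pos.2 ⟨m, by simp [hS]⟩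
    exact nonpos_of_mul_nonpos_right hle hcard
  intro i
  have := (Finset.sum_eq_zero_iff_of_nonpos fun i _ => hnonpos i).1 hsum i (Finset.mem_univ i)
  simp only [he] at this
  linarith

/-! ### Cut and clique inequalities over the assignment polytope -/

lemma sum_nodes {V : Type*} {r : V} (S : Finset (N1 r)) (g : V → ℝ) :
    ∑ i ∈ nodes S, g i = ∑ i ∈ S, g i.1 := by
  simp [nodes]

lemma sum_arcsIn_add_sum_deltaOut {x : Arc V → ℝ} (hx : x ∈ PAP V) {r : V}
    (S : Finset (N1 r)) :
    ∑ a ∈ arcsIn (nodes S), x a + ∑ a ∈ deltaOut (nodes S), x a = S.card := by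
  rw [← sum_outflow_singleton, sum_nodes, Finset.sum_congr rfl fun i _ => hx.2.1 i.1]
  simp

lemma sum_deltaIn_eq_sum_deltaOut {x : Arc V → ℝ} (hx : x ∈ PAP V) (S : Finset V) :
    ∑ a ∈ deltaIn S, x a = ∑ a ∈ deltaOut S, x a := by
  rw [← sub_eq_zero, ← sum_netInflow_singleton]
  exact Finset.sum_eq_zero fun i _ => by rw [hx.2.1, hx.2.2, sub_self]

/-- Summing flow conservation over `S`, the demand is the net inflow of `f`, hence at most the
entering capacity, which equals the leaving one. -/
lemma sum_le_sum_deltaOut_of_mem_QSCF {r : V} {b : N1 r → ℝ} {x f : Arc V → ℝ}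
    (h : (x, f) ∈ QSCF r b) (S : Finset (N1 r)) :
    ∑ i ∈ S, b i ≤ ∑ a ∈ deltaOut (nodes S), x a := by
  obtain ⟨hx, hf0, -, hfb, hfx⟩ := h
  have h1 := sum_netInflow_singleton f (nodes S)
  rw [sum_nodes, Finset.sum_congr rfl fun i _ =>
    show _ = b i by linarith [hfb i]] at h1
  rw [h1, ← sum_deltaIn_eq_sum_deltaOut hx]
  linarith [Finset.sum_le_sum fun a (_ : a ∈ deltaIn (nodes S)) => hfx a,
    Finset.sum_nonneg fun a (_ : a ∈ deltaOut (nodes S)) => hf0 a]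

/-- The demand vector of the single commodity flow: `-1` at the root and `b` elsewhere. -/
def demand {r : V} (b : N1 r → ℝ) (i : V) : ℝ :=
  if h : i = r then -1 else b ⟨i, h⟩

lemma nodes_subtype {V : Type*} [DecidableEq V] {r : V} {S : Finset V} (hr : r ∉ S) :
    nodes (r := r) (S.subtype fun i => i ≠ r) = S := by
  rw [nodes, Finset.subtype_map, Finset.filter_eq_self]
  exact fun i hi h => hr (h ▸ hi)

lemma demand_coe {V : Type*} [DecidableEq V] {r : V} (b : N1 r → ℝ) (i : N1 r) :
    demand b i.1 = b i := by
  simp [demand, i.2]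

lemma sum_demand_of_notMem {V : Type*} [DecidableEq V] {r : V} (b : N1 r → ℝ) {S : Finset V}
    (hr : r ∉ S) :
    ∑ i ∈ S, demand b i = ∑ i ∈ S.subtype fun i => i ≠ r, b i := by
  conv_lhs => rw [← nodes_subtype hr]
  rw [sum_nodes]
  exact Finset.sum_congr rfl fun i _ => demand_coe b i

lemma sum_demand_of_mem {V : Type*} [DecidableEq V] {r : V} (b : N1 r → ℝ) {S : Finset V}
    (hr : r ∈ S) :
    ∑ i ∈ S, demand b i = -1 + ∑ i ∈ (S.erase r).subtype fun i => i ≠ r, b i := by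
  rw [← Finset.add_sum_erase S _ hr, sum_demand_of_notMem b (Finset.notMem_erase r S)]
  simp [demand]

lemma exists_mem_QSCF {r : V} {b : N1 r → ℝ} (hb : b ∈ Bbar r) {x : Arc V → ℝ} (hx : x ∈ PAP V)
    (h : ∀ S ∈ S1 r, ∑ a ∈ deltaOut (nodes S), x a ≥ ∑ i ∈ S, b i) :
    ∃ f, (x, f) ∈ QSCF r b := by
  have hle (T : Finset (N1 r)) : ∑ i ∈ T, b i ≤ 1 :=
    hb.2 ▸ Finset.sum_le_sum_of_subset_of_nonneg (Finset.subset_univ T) fun i _ _ => hb.1 i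
  have hcut1 (T : Finset (N1 r)) : ∑ i ∈ T, b i ≤ ∑ a ∈ deltaOut (nodes T), x a := by
    by_cases hT : 2 ≤ T.card
    · exact h T hT
    -- Sets outside `S1 r`: for a singleton the leaving capacity is 1 by the degree equation, and `b
    -- i ≤ 1`.
    · obtain h0 | h1 : T.card = 0 ∨ T.card = 1 := by omega
      · rw [Finset.card_eq_zero.1 h0, Finset.sum_empty]
        exact Finset.sum_nonneg fun a _ => (hx.1 a).1
      · obtain ⟨i, rfl⟩ := Finset.card_eq_one.1 h1
        have : nodes ({i} : Finset (N1 r)) = {i.1} := by simp [nodes]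
        rw [this, hx.2.1]
        exact hle _
  obtain ⟨f, hf0, hfx, hfd⟩ := exists_flow_of_cut_condition (demand b) x (fun a => (hx.1 a).1)
    (by
      rw [sum_demand_of_mem b (Finset.mem_univ r)]
      have : ((Finset.univ : Finset V).erase r).subtype (fun i => i ≠ r) = Finset.univ := by
        ext i
        simpa using i.2
      rw [this, hb.2]
      norm_num)
    (by
      intro S
      by_cases hr : r ∈ S
      -- The supply at the root outweighs all other demand, so the total is nonpositive.
      · rw [sum_demand_of_mem b hr]
        linarith [hle ((S.erase r).subtype fun i => i ≠ r),
          Finset.sum_nonneg fun a (_ : a ∈ deltaIn S) => (hx.1 a).1]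
      · have := hcut1 (S.subtype fun i => i ≠ r)
        rwa [nodes_subtype hr, ← sum_demand_of_notMem b hr,
          ← sum_deltaIn_eq_sum_deltaOut hx] at this)
  refine ⟨f, hx, hf0, ?_, fun i => ?_, hfx⟩
  · have := hfd r
    simp only [demand, dite_true] at this
    linarith
  · have := hfd i.1
    rw [demand_coe] at this
    linarith

lemma PSCF_eq_cut {r : V} {b : N1 r → ℝ} (hb : b ∈ Bbar r) :
    PSCF r b = {x | x ∈ PAP V ∧
      ∀ S ∈ S1 r, ∑ a ∈ deltaOut (nodes S), x a ≥ ∑ i ∈ S, b i} := by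
  ext x
  constructor
  · rintro ⟨⟨y, f⟩, h, rfl⟩
    exact ⟨h.1, fun S _ => sum_le_sum_deltaOut_of_mem_QSCF h S⟩
  · rintro ⟨hx, h⟩
    obtain ⟨f, hf⟩ := exists_mem_QSCF hb hx h
    exact ⟨(x, f), hf, rfl⟩

lemma cut_iff_clique {r : V} (b : N1 r → ℝ) {x : Arc V → ℝ} (hx : x ∈ PAP V)
    (S : Finset (N1 r)) :
    ∑ a ∈ deltaOut (nodes S), x a ≥ ∑ i ∈ S, b i ↔
      ∑ a ∈ arcsIn (nodes S), x a ≤ (S.card : ℝ) - ∑ i ∈ S, b i := by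
  have := sum_arcsIn_add_sum_deltaOut hx S
  constructor <;> intro h <;> linarith

lemma PSCF_eq_clique {r : V} {b : N1 r → ℝ} (hb : b ∈ Bbar r) :
    PSCF r b = {x | x ∈ PAP V ∧
      ∀ S ∈ S1 r, ∑ a ∈ arcsIn (nodes S), x a ≤ (S.card : ℝ) - ∑ i ∈ S, b i} := by
  rw [PSCF_eq_cut hb]
  ext x
  exact and_congr_right fun hx => forall₂_congr fun S _ => cut_iff_clique b hx S

lemma sum_uniformB {V : Type*} [Fintype V] {r : V} (S : Finset (N1 r)) :
    ∑ i ∈ S, uniformB r i = (S.card : ℝ) / ((Fintype.card V : ℝ) - 1) := by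
  simp [uniformB, div_eq_mul_inv]

lemma uniformB_mem_Bbar (hn : 2 ≤ Fintype.card V) (r : V) : uniformB r ∈ Bbar r := by
  have h : (0 : ℝ) < (Fintype.card V : ℝ) - 1 := by
    have : (2 : ℝ) ≤ Fintype.card V := by exact_mod_cast hn
    linarith
  refine ⟨fun i => by unfold uniformB; positivity, ?_⟩
  rw [sum_uniformB, Finset.card_univ, Fintype.card_subtype_compl, Fintype.card_subtype_eq,
    Nat.cast_sub (by omega), Nat.cast_one, div_self h.ne']

end

theorem mainTheorem7 {V : Type*} [Fintype V] [DecidableEq V] (hn : 4 ≤ Fintype.card V) (r : V) :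
    (∀ b ∈ Bbar r,
      PSCF r b = {x | x ∈ PAP V ∧
        ∀ S ∈ S1 r, ∑ a ∈ deltaOut (nodes S), x a ≥ ∑ i ∈ S, b i} ∧
      (∀ x ∈ PAP V, ∀ S ∈ S1 r,
        (∑ a ∈ deltaOut (nodes S), x a ≥ ∑ i ∈ S, b i ↔
          ∑ a ∈ arcsIn (nodes S), x a ≤ (S.card : ℝ) - ∑ i ∈ S, b i)) ∧
      PSCF r b = {x | x ∈ PAP V ∧
        ∀ S ∈ S1 r, ∑ a ∈ arcsIn (nodes S), x a ≤ (S.card : ℝ) - ∑ i ∈ S, b i}) ∧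
    (uniformB r ∈ Bbar r ∧
      (∀ S ∈ S1 r, (S.card : ℝ) - ∑ i ∈ S, uniformB r i =
        (S.card : ℝ) - (S.card : ℝ) / ((Fintype.card V : ℝ) - 1)) ∧
      PSCF r (uniformB r) = {x | x ∈ PAP V ∧
        ∀ S ∈ S1 r, ∑ a ∈ arcsIn (nodes S), x a ≤
          (S.card : ℝ) - (S.card : ℝ) / ((Fintype.card V : ℝ) - 1)}) := by
  have hu := uniformB_mem_Bbar (by omega : 2 ≤ Fintype.card V) r
  refine ⟨fun b hb => ⟨PSCF_eq_cut hb, fun x hx S _ => cut_iff_clique b hx S,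
    PSCF_eq_clique hb⟩, hu, fun S _ => by rw [sum_uniformB], ?_⟩
  simpa only [sum_uniformB] using PSCF_eq_clique hu
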